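/- Let $k$ be an algebraically closed field of characteristic different from $2$, let $n, r$ be positive integers, and let $V = k^n$ be equipped with a nondegenerate bilinear form $\langle\cdot,\cdot\rangle$ that is either symmetric or skew-symmetric. Let $\phi : V \to V^*$ be the isomorphism $\phi(v)(w) = \langle v, w\rangle$ and let $\rho(A) = \phi^{-1}\circ A^*\circ\phi$ be the adjoint involution on $\operatorname{End}_k(V)$, where $A^* : V^* \to V^*$ is the dual map of $A$. For a subspace $W \subseteq V$ let $W^\perp = \{x \in V : \langle w, x\rangle = 0 \text{ for all } w \in W\}$, and call $\dim_k (W \cap W^\perp)$ the isotropy rank of $W$. A subspace $W$ is $\rho$-invariant under a tuple $A_\bullet = (A_1,\dots,A_r) \in \operatorname{End}_k(V)^r$ if $A_i W \subseteq W$ and $\rho(A_i) W \subseteq W$ for all $i$. For non-negative integers $l, d$ let $Z(\ge l, d, r; V) \subseteq \operatorname{End}_k(V)^r$ be the set of tuples having some $\rho$-invariant subspace of dimension $d$ and isotropy rank at least $l$, and let $Z(l,d,r;V) = Z(\ge l,d,r;V) \setminus Z(\ge l+1,d,r;V)$. Identify $\operatorname{End}_k(V)^r$ with the affine space $\mathbb{A}^{n^2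 r}_k$ by matrix entries and give it the Zariski topology. Then for all $l, d \ge 0$ the set $Z(\ge l, d, r; V)$ is Zariski closed in $\operatorname{End}_k(V)^r$, and consequently $Z(l, d, r; V)$ is locally closed in $\operatorname{End}_k(V)^r$ (the intersection of a Zariski open and a Zariski closed subset, hence a quasi-affine variety). -/

import Mathlib

open scoped Topology

/-- The Zariski topology on the affine space `𝔸_k^σ` of `k`-points, for an arbitrary index set `σ`:
the closed sets are the common zero sets of families of polynomials. -/
@[reducible] def zariskiTopology (k σ : Type*) [Field k] : TopologicalSpace (σ → k) :=
  TopologicalSpace.ofClosed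
    {Z | ∃ S : Set (MvPolynomial σ k), Z = {x | ∀ p ∈ S, MvPolynomial.eval x p = 0}}
    ⟨{1}, by ext x; simp⟩
    (by
      intro F hF
      refine ⟨{p | ∃ Z ∈ F, ∀ x ∈ Z, MvPolynomial.eval x p = 0}, ?_⟩
      ext x
      constructor
      · rintro hx p ⟨Z, hZ, hp⟩
        exact hp x (hx Z hZ)
      · intro hx Z hZ
        obtain ⟨S, rfl⟩ := hF hZ
        exact fun p hp => hx p ⟨_, hZ, fun y hy => hy p hp⟩)
    (by
      rintro _ ⟨S, rfl⟩ _ ⟨T, rfl⟩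
      refine ⟨{p | ∃ f ∈ S, ∃ g ∈ T, p = f * g}, ?_⟩
      ext x
      constructor
      · rintro (hx | hx) p ⟨f, hf, g, hg, rfl⟩
        · simp [hx f hf]
        · simp [hx g hg]
      · intro hx
        by_contra hcon
        simp only [Set.mem_union, Set.mem_ofPred_eq, not_or, not_forall] at hcon
        obtain ⟨⟨f, hf, hfx⟩, g, hg, hgx⟩ := hcon
        have := hx (f * g) ⟨f, hf, g, hg, rfl⟩
        rw [map_mul] at this
        exact (mul_ne_zero hfx hgx) this)

/-- The identification of `End_k(k^n)^r` with the affine space `𝔸_k^{n²r}` by matrix entries. -/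
noncomputable def endTupleCoords (k : Type*) [Field k] (n r : ℕ) :
    (Fin r → Module.End k (Fin n → k)) ≃ₗ[k] (Fin r × Fin n × Fin n → k) where
  toFun A := fun e => LinearMap.toMatrix' (A e.1) e.2.1 e.2.2
  invFun M := fun i => Matrix.toLin' (Matrix.of fun a b => M (i, a, b))
  map_add' A A' := by ext e; simp
  map_smul' c A := by ext e; simp
  left_inv A := by
    funext i
    exact Matrix.toLin'_toMatrix' (A i)
  right_inv M := by
    funext e
    simp only [LinearMap.toMatrix'_toLin', Matrix.of_apply]

/-- The Zariski topology on `End_k(k^n)^r ≅ 𝔸_k^{n²r}`. -/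
@[reducible] noncomputable def endTupleZariski (k : Type*) [Field k] (n r : ℕ) :
    TopologicalSpace (Fin r → Module.End k (Fin n → k)) :=
  TopologicalSpace.induced (endTupleCoords k n r) (zariskiTopology k (Fin r × Fin n × Fin n))

section BilinearSpace

variable {k V : Type*} [Field k] [AddCommGroup V] [Module k V] [FiniteDimensional k V]

/-- The adjoint involution `ρ(A) = φ⁻¹ ∘ A* ∘ φ`, where `φ : V → V*`, `φ v w = ⟨v, w⟩`. -/
noncomputable def adjointInvolution (B : LinearMap.BilinForm k V) (hB : B.Nondegenerate)
    (A : Module.End k V) : Module.End k V :=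
  (B.toDual hB).symm.toLinearMap ∘ₗ A.dualMap ∘ₗ (B.toDual hB).toLinearMap

/-- The isotropic radical `Iso(W) = W ∩ W^⊥`. -/
def isotropicRadical (B : LinearMap.BilinForm k V) (W : Submodule k V) : Submodule k V :=
  W ⊓ B.orthogonal W

/-- The isotropy rank `dim Iso(W)`. -/
noncomputable def isotropyRank (B : LinearMap.BilinForm k V) (W : Submodule k V) : ℕ :=
  Module.finrank k (isotropicRadical B W)

/-- `W` is `ρ`-invariant under the tuple `A`: `A_i W ⊆ W` and `ρ(A_i) W ⊆ W` for all `i`. -/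
def IsRhoInvariant (B : LinearMap.BilinForm k V) (hB : B.Nondegenerate) {r : ℕ}
    (A : Fin r → Module.End k V) (W : Submodule k V) : Prop :=
  ∀ i, W.map (A i) ≤ W ∧ W.map (adjointInvolution B hB (A i)) ≤ W

/-- `Z(W, r; V)`: the tuples having `W` as a `ρ`-invariant subspace. -/
def invariantLocus (B : LinearMap.BilinForm k V) (hB : B.Nondegenerate) (r : ℕ)
    (W : Submodule k V) : Set (Fin r → Module.End k V) :=
  {A | IsRhoInvariant B hB A W}

/-- `Z(≥ l, d, r; V)`: the union of `Z(W, r; V)` over all `W` of dimension `d` and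
isotropy rank at least `l`. -/
def locusGE (B : LinearMap.BilinForm k V) (hB : B.Nondegenerate) (l d r : ℕ) :
    Set (Fin r → Module.End k V) :=
  ⋃ W ∈ {W : Submodule k V | Module.finrank k W = d ∧ l ≤ isotropyRank B W},
    invariantLocus B hB r W

/-- `Z(l, d, r; V) = Z(≥ l, d, r; V) \ Z(≥ l + 1, d, r; V)`. -/
def locusEQ (B : LinearMap.BilinForm k V) (hB : B.Nondegenerate) (l d r : ℕ) :
    Set (Fin r → Module.End k V) :=
  locusGE B hB l d r \ locusGE B hB (l + 1) d r

end BilinearSpace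

/-! The locus is the projection to the tuples of a closed incidence set in a projective space times
affine space, so elimination theory (`isClosed_setOf_exists_ne_zero`) makes it closed. The
projective space is that of all d-tensors `p`, and rank conditions take the place of the Plücker
relations. A nonzero alternating `p` has contraction matrix of rank at least d
(`le_rank_contractionMatrix`). When the rank is exactly d, its column space is a d-dimensional
subspace W, and every such W arises from the Plücker tensor of a basis. Invariance of W says that
adjoining the images of the columns under all `A i` and `ρ (A i)` keeps the rank at most d. Isotropy
rank at least l says that the Gram matrix of the columns has rank at most d - l. Through minors
these become equations homogeneous in `p` and polynomial in the tuple. -/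

/-! ### Zariski closed sets -/

theorem isClosed_zariskiTopology_iff {k σ : Type*} [Field k] {Z : Set (σ → k)} :
    IsClosed[zariskiTopology k σ] Z ↔
      ∃ S : Set (MvPolynomial σ k), Z = {x | ∀ p ∈ S, MvPolynomial.eval x p = 0} := by
  rw [← @isOpen_compl_iff _ _ (zariskiTopology k σ)]
  change Zᶜᶜ ∈ _ ↔ _
  rw [compl_compl]
  rfl

theorem isClosed_zariskiTopology_of_separated {k σ : Type*} [Field k] {Z : Set (σ → k)}
    (h : ∀ a ∉ Z, ∃ p : MvPolynomial σ k,
      (∀ b ∈ Z, MvPolynomial.eval b p = 0) ∧ MvPolynomial.eval a p ≠ 0) :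
    IsClosed[zariskiTopology k σ] Z := by
  refine isClosed_zariskiTopology_iff.2
    ⟨{p | ∀ b ∈ Z, MvPolynomial.eval b p = 0}, Set.Subset.antisymm (fun x hx p hp => hp x hx) ?_⟩
  intro x hx
  by_contra hxZ
  obtain ⟨p, hp, hpx⟩ := h x hxZ
  exact hpx (hx p hp)

/-! ### Elimination theory -/

namespace MvPolynomial

theorem map_homogeneousComponent {σ R S : Type*} [CommSemiring R] [CommSemiring S] (f : R →+* S)
    (m : ℕ) (p : MvPolynomial σ R) :
    map f (homogeneousComponent m p) = homogeneousComponent m (map f p) := by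
  ext u
  simp only [coeff_map, coeff_homogeneousComponent]
  split_ifs <;> simp

attribute [local instance] MvPolynomial.gradedAlgebra in
theorem homogeneousComponent_mem_span {σ R : Type*} [CommRing R] {F : Set (MvPolynomial σ R)}
    (hF : ∀ f ∈ F, ∃ e, f.IsHomogeneous e) {p : MvPolynomial σ R} (hp : p ∈ Ideal.span F) (m : ℕ) :
    homogeneousComponent m p ∈ Ideal.span F :=
  homogeneousComponent_mem_of_mem
    (Ideal.homogeneous_span _ F fun f hf => (hF f hf).imp fun _ he => he) hp m

/-- Projective Nullstellensatz: every variable vanishes on the zero locus, hence lies in the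
radical, and the ideal of variables is finitely generated. -/
theorem exists_pow_idealOfVars_le_span {k σ : Type*} [Field k] [IsAlgClosed k] [Finite σ]
    {G : Set (MvPolynomial σ k)} (hG : ∀ x : σ → k, (∀ g ∈ G, eval x g = 0) → x = 0) :
    ∃ N, idealOfVars σ k ^ N ≤ Ideal.span G := by
  refine Ideal.exists_pow_le_of_le_radical_of_fg ?_ (idealOfVars_fg σ k)
  rw [← vanishingIdeal_zeroLocus_eq_radical (K := k), idealOfVars, Ideal.span_le]
  rintro _ ⟨i, rfl⟩
  rw [zeroLocus_span]
  intro x hx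
  have : x = 0 := hG x fun g hg => by simpa [aeval_eq_eval] using hx g hg
  simp [this]

/-- **Main theorem of elimination theory**: the projection of a closed subset of `ℙ(k^σ) × k^τ` to
`k^τ` is Zariski closed. -/
theorem isClosed_setOf_exists_ne_zero {k σ τ : Type*} [Field k] [IsAlgClosed k] [Finite σ]
    (F : Set (MvPolynomial σ (MvPolynomial τ k))) (hF : ∀ f ∈ F, ∃ e, f.IsHomogeneous e) :
    IsClosed[zariskiTopology k τ]
      {a | ∃ x : σ → k, x ≠ 0 ∧ ∀ f ∈ F, eval x (map (eval a) f) = 0} := by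
  classical
  refine isClosed_zariskiTopology_of_separated fun a ha => ?_
  obtain ⟨N, hN⟩ := exists_pow_idealOfVars_le_span (G := map (eval a) '' F) fun x hx => by
    by_contra hx0
    exact ha ⟨x, hx0, fun f hf => hx _ ⟨f, hf, rfl⟩⟩
  rw [← Ideal.map_span] at hN
  have hsurj : Function.Surjective (map (σ := σ) (eval (R := k) a)) :=
    map_surjective _ fun c => ⟨C c, by simp⟩
  -- Each monomial of degree `N` lies in the ideal specialized at `a`. A preimage in the ideal of
  -- `F` can be made homogeneous by taking its degree `N` component.
  have lift (u : σ →₀ ℕ) (hu : u.degree = N) : ∃ h ∈ Ideal.span F, h.IsHomogeneous N ∧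
      map (eval a) h = monomial u 1 := by
    have hmem : monomial u (1 : k) ∈ Ideal.map (map (eval a)) (Ideal.span F) :=
      hN ((monomial_mem_pow_idealOfVars_iff N u one_ne_zero).2 hu.ge)
    obtain ⟨h, hh, hhu⟩ := (Ideal.mem_map_iff_of_surjective _ hsurj).1 hmem
    refine ⟨homogeneousComponent N h, homogeneousComponent_mem_span hF hh N,
      homogeneousComponent_isHomogeneous N h, ?_⟩
    rw [map_homogeneousComponent, hhu]
    exact homogeneousComponent_eq_self (isHomogeneous_monomial _ hu)
  obtain ⟨S, hS⟩ : ∃ S : Finset (σ →₀ ℕ), ∀ u, u ∈ S ↔ u.degree = N :=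
    ⟨(Finsupp.finite_of_degree_eq (σ := σ) N).toFinset, fun u => by simp⟩
  choose h hspan hhom hmap using fun u : S => lift u ((hS u).1 u.2)
  -- This matrix specializes to the identity at `a`. Over a point of the projection, it kills the
  -- vector of degree `N` monomials in `x`, so its determinant separates `a` from the projection.
  let M : Matrix S S (MvPolynomial τ k) := Matrix.of fun u v => coeff v.1 (h u)
  have hdet (b : τ → k) : eval b M.det = (Matrix.of fun u v : S =>
      coeff v.1 (map (eval b) (h u))).det := by
    rw [RingHom.map_det]
    congr 1
  refine ⟨M.det, ?_, ?_⟩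
  · rintro b ⟨x, hx, hxF⟩
    rw [hdet]
    by_contra hne
    have hzero (u : S) : eval x (map (eval b) (h u)) = 0 := by
      have : Ideal.span F ≤ RingHom.ker ((eval x).comp (map (eval b))) :=
        Ideal.span_le.2 fun f hf => hxF f hf
      exact this (hspan u)
    have hvec : (fun v : S => v.1.prod fun i e => x i ^ e) = 0 := by
      refine Matrix.eq_zero_of_mulVec_eq_zero hne ?_
      ext u
      rw [Pi.zero_apply, ← hzero u, eval_eq]
      simp only [Matrix.mulVec, dotProduct, Matrix.of_apply]
      rw [Finset.sum_coe_sort S fun v => coeff v (map (eval b) (h u)) * v.prod fun i e => x i ^ e]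
      refine (Finset.sum_subset ?_ ?_).symm
      · intro v hv
        have := ((hhom u).map (eval b)) (mem_support_iff.1 hv)
        rw [hS, Finsupp.degree_eq_weight_one]
        exact this
      · intro v _ hv
        simp [notMem_support_iff.1 hv]
    apply hx
    ext i
    -- The monomial `x i ^ N` is an entry of the vanishing vector, which forces `x = 0`.
    have := congr_fun hvec ⟨Finsupp.single i N, (hS _).2 (by simp)⟩
    simp only [Pi.zero_apply, Finsupp.prod_single_index, pow_zero] at this
    by_contra hne
    exact pow_ne_zero N hne this
  · rw [hdet]
    have : (Matrix.of fun u v : S => coeff v.1 (map (eval a) (h u))) = 1 := by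
      ext u v
      rw [Matrix.of_apply, hmap, coeff_monomial, Matrix.one_apply]
      exact if_congr Subtype.ext_iff.symm rfl rfl
    simp [this]

end MvPolynomial

/-! ### Ranks, minors and invariant column spaces -/

namespace Matrix

variable {k m n ω : Type*}

theorem exists_linearIndependent_col_of_le_rank [Field k] [Fintype n] (M : Matrix m n k) {e : ℕ}
    (he : e ≤ M.rank) : ∃ c : Fin e → n, LinearIndependent k fun i => M.col (c i) := by
  rw [rank_eq_finrank_span_cols] at he
  have := FiniteDimensional.span_of_finite k (Set.finite_range M.col)
  obtain ⟨f, hf, -, hli⟩ := Submodule.exists_fun_fin_finrank_span_eq k (Set.range M.col)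
  choose c hc using hf
  refine ⟨c ∘ Fin.castLE he, ?_⟩
  rw [show (fun i => M.col ((c ∘ Fin.castLE he) i)) = f ∘ Fin.castLE he from funext fun i => hc _]
  exact hli.comp _ (Fin.castLE_injective he)

theorem exists_linearIndependent_row_of_le_rank [Field k] [Fintype m] [Fintype n]
    (M : Matrix m n k) {e : ℕ} (he : e ≤ M.rank) :
    ∃ r : Fin e → m, LinearIndependent k fun i => M.row (r i) :=
  exists_linearIndependent_col_of_le_rank Mᵀ (by rwa [rank_transpose])

theorem rank_lt_iff_forall_det_submatrix_eq_zero [Field k] [Fintype m] [Fintype n]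
    (M : Matrix m n k) (e : ℕ) :
    M.rank < e ↔ ∀ (r : Fin e → m) (c : Fin e → n), (M.submatrix r c).det = 0 := by
  constructor
  · intro h r c
    by_contra hne
    have h1 := rank_of_det_ne_zero hne
    have h2 := rank_submatrix_le M r c
    rw [Fintype.card_fin] at h1
    omega
  · intro h
    by_contra! hle
    obtain ⟨c, hc⟩ := M.exists_linearIndependent_col_of_le_rank hle
    have hrank : (M.submatrix id c).rank = e := by
      rw [← rank_transpose, LinearIndependent.rank_matrix (M := (M.submatrix id c)ᵀ) hc,
        Fintype.card_fin]
    obtain ⟨r, hr⟩ := (M.submatrix id c).exists_linearIndependent_row_of_le_rank hrank.ge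
    have hu := linearIndependent_rows_iff_isUnit.1
      (show LinearIndependent k (M.submatrix r c).row from hr)
    exact ((isUnit_iff_isUnit_det _).1 hu).ne_zero (h r c)

/-- The block matrix `[M | T₁ M | T₂ M | ⋯]`. -/
def orbitMatrix [CommRing k] [Fintype m] (T : ω → Matrix m m k) (M : Matrix m n k) :
    Matrix m (Option ω × n) k :=
  of fun a oc => oc.1.elim (M a oc.2) fun o => (T o * M) a oc.2

theorem rank_le_rank_orbitMatrix [Field k] [Fintype m] [Fintype n] [Fintype ω]
    (T : ω → Matrix m m k) (M : Matrix m n k) : M.rank ≤ (orbitMatrix T M).rank :=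
  rank_submatrix_le (orbitMatrix T M) id fun c => (none, c)

/-- The column space of the orbit matrix contains that of `M`, so the rank fails to grow exactly
when the two coincide. -/
theorem rank_orbitMatrix_le_rank_iff [Field k] [Fintype m] [Fintype n] [Fintype ω] [DecidableEq m]
    (T : ω → Matrix m m k) (M : Matrix m n k) :
    (orbitMatrix T M).rank ≤ M.rank ↔
      ∀ o, (LinearMap.range M.mulVecLin).map (T o).mulVecLin ≤ LinearMap.range M.mulVecLin := by
  have hcol (o : ω) (c : n) : (orbitMatrix T M).col (some o, c) = T o *ᵥ M.col c := by
    ext a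
    simp [orbitMatrix, mul_apply, mulVec, dotProduct]
  simp only [range_mulVecLin, rank_eq_finrank_span_cols]
  have hle : Submodule.span k (Set.range M.col) ≤
      Submodule.span k (Set.range (orbitMatrix T M).col) :=
    Submodule.span_mono (by rintro _ ⟨c, rfl⟩; exact ⟨(none, c), rfl⟩)
  constructor
  · intro h o
    have heq := Submodule.eq_of_le_of_finrank_le hle h
    rw [Submodule.map_span_le]
    rintro _ ⟨c, rfl⟩
    rw [heq]
    exact Submodule.subset_span ⟨(some o, c), hcol o c⟩
  · intro h
    refine Submodule.finrank_mono (Submodule.span_le.2 ?_)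
    rintro _ ⟨⟨_ | o, c⟩, rfl⟩
    · exact Submodule.subset_span ⟨c, rfl⟩
    · rw [hcol]
      exact h o (Submodule.mem_map_of_mem (Submodule.subset_span ⟨c, rfl⟩))

end Matrix

/-! ### Alternating tensors and their contractions -/

section Tensor

open Matrix

variable {k ι : Type*} {d : ℕ}

/-- The multilinear form on `(k^ι)^d` with values `p I` on the tuples of basis vectors. -/
noncomputable def tensorForm [CommRing k] [Fintype ι] (p : (Fin d → ι) → k) :
    MultilinearMap k (fun _ : Fin d => ι → k) k :=
  ∑ I, p I • (MultilinearMap.mkPiAlgebra k (Fin d) k).compLinearMap fun s => LinearMap.proj (I s)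

theorem tensorForm_apply [CommRing k] [Fintype ι] (p : (Fin d → ι) → k) (ξ : Fin d → ι → k) :
    tensorForm p ξ = ∑ I, p I * ∏ s, ξ s (I s) := by
  simp [tensorForm]

theorem tensorForm_single [CommRing k] [Fintype ι] [DecidableEq ι] (p : (Fin d → ι) → k)
    (J : Fin d → ι) : tensorForm p (fun s => Pi.single (J s) 1) = p J := by
  rw [tensorForm_apply, Finset.sum_eq_single J]
  · simp
  · intro I _ hI
    obtain ⟨s, hs⟩ := Function.ne_iff.1 hI
    rw [Finset.prod_eq_zero (Finset.mem_univ s), mul_zero]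
    simp [hs]
  · simp

/-- The tensor `p` is alternating. -/
def IsAlternatingTensor [CommRing k] [Fintype ι] (p : (Fin d → ι) → k) : Prop :=
  ∀ (ξ : Fin d → ι → k) (i j : Fin d), ξ i = ξ j → i ≠ j → tensorForm p ξ = 0

/-- The matrix whose columns are the contractions of the tensor `p` in all but one slot. -/
def contractionMatrix (p : (Fin d → ι) → k) : Matrix ι (Fin d × (Fin d → ι)) k :=
  of fun a c => p (Function.update c.2 c.1 a)

/-- If the rank were below d, any d basis vectors would have a nontrivial combination `η` whose
contraction with `p` is zero. Putting `η` in a slot `i` with `c i ≠ 0` leaves, by alternation, only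
`c i` times the value of `p`, so that value vanishes. -/
theorem le_rank_contractionMatrix [Field k] [Fintype ι] [DecidableEq ι] {p : (Fin d → ι) → k}
    (hp : IsAlternatingTensor p) (hp0 : p ≠ 0) : d ≤ (contractionMatrix p).rank := by
  by_contra! hlt
  apply hp0
  ext J
  let P : (ι → k) [⋀^Fin d]→ₗ[k] k := { tensorForm p with map_eq_zero_of_eq' := hp }
  let ξ : Fin d → ι → k := fun s => Pi.single (J s) 1
  let T := (contractionMatrix p)ᵀ.mulVecLin
  have hdep : ¬ LinearIndependent k fun s => T.rangeRestrict (ξ s) := by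
    intro h
    have := h.fintype_card_le_finrank
    rw [Fintype.card_fin] at this
    rw [← rank_transpose] at hlt
    exact absurd this (not_le.2 hlt)
  obtain ⟨c, hc, i, hi⟩ := Fintype.not_linearIndependent_iff.1 hdep
  let η := ∑ s, c s • ξ s
  have hη : T η = 0 := by
    have := congr_arg Subtype.val hc
    simpa [η, map_sum] using this
  let f := (tensorForm p).toLinearMap ξ i
  have h1 : f η = c i • P ξ := by
    rw [map_sum, Finset.sum_eq_single i]
    · rw [map_smul]
      congr 1
      exact congr_arg P (Function.update_eq_self i ξ)
    · intro s _ hs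
      rw [map_smul]
      have : f (ξ s) = 0 := P.map_update_self ξ hs.symm
      rw [this, smul_zero]
    · simp
  have h2 : f η = T η (i, J) := by
    have hf (a : ι) : f (Pi.single a 1) = p (Function.update J i a) := by
      rw [← tensorForm_single p]
      refine congr_arg (tensorForm p) (funext fun s => ?_)
      obtain rfl | hs := eq_or_ne s i
      · simp
      · simp [hs, ξ]
    rw [LinearMap.pi_apply_eq_sum_univ f]
    simp only [T, mulVecLin_apply, mulVec, dotProduct, contractionMatrix, transpose_apply, of_apply]
    refine Finset.sum_congr rfl fun a _ => ?_
    rw [← hf, smul_eq_mul, mul_comm]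
    congr 2
    ext b
    simp [Pi.single_apply, eq_comm]
  have h3 : P ξ = p J := tensorForm_single p J
  rw [h2, hη, h3] at h1
  simpa [hi] using h1.symm

/-- The Plücker tensor of a basis of `W` works: as a determinant is linear in each row, every
contraction is a combination of the basis vectors. -/
theorem exists_isAlternatingTensor_range_contractionMatrix_le [Field k] [Fintype ι]
    [DecidableEq ι] (W : Submodule k (ι → k)) (hW : Module.finrank k W = d) :
    ∃ p : (Fin d → ι) → k, p ≠ 0 ∧ IsAlternatingTensor p ∧
      LinearMap.range (contractionMatrix p).mulVecLin ≤ W := by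
  let b := Module.finBasisOfFinrankEq k W hW
  let X : Matrix ι (Fin d) k := of fun a j => (b j : ι → k) a
  let P : (ι → k) [⋀^Fin d]→ₗ[k] k := detRowAlternating.compLinearMap Xᵀ.mulVecLin
  let p : (Fin d → ι) → k := fun I => (X.submatrix I id).det
  have hP : tensorForm p = P.toMultilinearMap := by
    refine Module.Basis.ext_multilinear (fun _ => Pi.basisFun k ι) fun J => ?_
    simp only [Pi.basisFun_apply, tensorForm_single]
    refine congr_arg det (ext fun s j => ?_)
    simp [X]
  refine ⟨p, ?_, ?_, ?_⟩
  · have hX : d ≤ X.rank := by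
      rw [← rank_transpose, LinearIndependent.rank_matrix (M := Xᵀ), Fintype.card_fin]
      exact b.linearIndependent.map' W.subtype W.ker_subtype
    obtain ⟨r, hr⟩ := X.exists_linearIndependent_row_of_le_rank hX
    have hu := linearIndependent_rows_iff_isUnit.1
      (show LinearIndependent k (X.submatrix r id).row from hr)
    exact fun h => ((isUnit_iff_isUnit_det _).1 hu).ne_zero (congr_fun h r)
  · intro ξ i j hij hne
    rw [hP]
    exact P.map_eq_zero_of_eq ξ hij hne
  · rw [range_mulVecLin, Submodule.span_le]
    rintro _ ⟨⟨s, J⟩, rfl⟩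
    let f := detRowAlternating.toMultilinearMap.toLinearMap (X.submatrix J id) s
    have : (contractionMatrix p).col (s, J) =
        ∑ j, f (fun i => if j = i then 1 else 0) • (b j : ι → k) := by
      ext a
      have h1 : (contractionMatrix p).col (s, J) a = f (X a) :=
        congr_arg det (funext fun i => Function.apply_update (fun _ u => X u) J s a i)
      rw [h1, LinearMap.pi_apply_eq_sum_univ f]
      simp [X, mul_comm]
    rw [this]
    exact Submodule.sum_mem _ fun j _ => W.smul_mem _ (b j).2

/-- Rank-nullity for pairing with the columns of `M`, restricted to their span `W`: the kernel is `W
∩ W^⊥`, and the image is the range of the Gram matrix. -/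
theorem rank_gram_add_isotropyRank [Field k] [Fintype ι] [DecidableEq ι] {c : Type*} [Fintype c]
    (B : LinearMap.BilinForm k (ι → k)) (M : Matrix ι c k) :
    (Mᵀ * LinearMap.BilinForm.toMatrix' B * M).rank +
      isotropyRank B (LinearMap.range M.mulVecLin) = M.rank := by
  set W := LinearMap.range M.mulVecLin with hW
  let T := (Mᵀ * LinearMap.BilinForm.toMatrix' B).mulVecLin
  have hT (w : ι → k) : T w = 0 ↔ ∀ v ∈ W, B v w = 0 := by
    have hB (y : c → k) : B (M *ᵥ y) w = T w ⬝ᵥ y := by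
      conv_lhs => rw [← toBilin'_toMatrix' B, toBilin'_apply']
      simp only [T, mulVecLin_apply]
      rw [← mulVec_mulVec, dotProduct_comm _ y, dotProduct_mulVec y, vecMul_transpose]
    constructor
    · rintro h _ ⟨y, rfl⟩
      simp [hB, h]
    · intro h
      refine dotProduct_eq_zero _ fun y => ?_
      rw [← hB]
      exact h _ ⟨y, rfl⟩
  have hker : (LinearMap.ker (T.domRestrict W)).map W.subtype = isotropicRadical B W := by
    ext w
    simp [isotropicRadical, LinearMap.BilinForm.mem_orthogonal_iff, hT, and_comm]
  have h1 := (T.domRestrict W).finrank_range_add_finrank_ker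
  rw [← Submodule.finrank_map_subtype_eq, hker] at h1
  rw [isotropyRank, rank, rank, ← hW, ← h1, LinearMap.range_domRestrict, hW, ← LinearMap.range_comp,
    ← mulVecLin_mul]

end Tensor

/-! ### Equations for the incidence set -/

section Locus

open Matrix MvPolynomial

variable {k : Type*} [Field k] {n r d : ℕ}

/-- The matrices of the endomorphisms `A i` and `ρ (A i)`. -/
noncomputable def adjointPairMatrix (B : LinearMap.BilinForm k (Fin n → k)) (hB : B.Nondegenerate)
    (A : Fin r → Module.End k (Fin n → k)) : Fin r ⊕ Fin r → Matrix (Fin n) (Fin n) k :=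
  Sum.elim (fun i => (A i).toMatrix') fun i => (adjointInvolution B hB (A i)).toMatrix'

/-- The orbit bound does double duty: with the lower bound for alternating tensors it pins the
contraction rank to d, and it then expresses invariance. -/
theorem mem_locusGE_iff (B : LinearMap.BilinForm k (Fin n → k)) (hB : B.Nondegenerate) (l d : ℕ)
    (A : Fin r → Module.End k (Fin n → k)) :
    A ∈ locusGE B hB l d r ↔ ∃ p : (Fin d → Fin n) → k, p ≠ 0 ∧ IsAlternatingTensor p ∧
      (orbitMatrix (adjointPairMatrix B hB A) (contractionMatrix p)).rank < d + 1 ∧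
      ((contractionMatrix p)ᵀ * LinearMap.BilinForm.toMatrix' B * contractionMatrix p).rank <
        d + 1 - l := by
  have hinv (W : Submodule k (Fin n → k)) : IsRhoInvariant B hB A W ↔
      ∀ o, W.map (adjointPairMatrix B hB A o).mulVecLin ≤ W := by
    simp only [IsRhoInvariant, Sum.forall, adjointPairMatrix, Sum.elim_inl, Sum.elim_inr,
      ← toLin'_apply', toLin'_toMatrix', forall_and]
  have key (p : (Fin d → Fin n) → k) (hp : (contractionMatrix p).rank = d) :
      ((orbitMatrix (adjointPairMatrix B hB A) (contractionMatrix p)).rank < d + 1 ↔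
        IsRhoInvariant B hB A (LinearMap.range (contractionMatrix p).mulVecLin)) ∧
      (((contractionMatrix p)ᵀ * LinearMap.BilinForm.toMatrix' B * contractionMatrix p).rank <
        d + 1 - l ↔ l ≤ isotropyRank B (LinearMap.range (contractionMatrix p).mulVecLin)) := by
    constructor
    · rw [hinv, ← rank_orbitMatrix_le_rank_iff, hp, Nat.lt_succ_iff]
    -- For `l > d` the truncated `d + 1 - l` is 0 and both sides are false; writing `d - l + 1`
    -- would break this case.
    · have := rank_gram_add_isotropyRank B (contractionMatrix p)
      omega
  simp only [locusGE, Set.mem_iUnion, invariantLocus, Set.mem_ofPred_eq, exists_prop]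
  constructor
  · rintro ⟨W, ⟨hW, hl⟩, hA⟩
    obtain ⟨p, hp0, hp, hle⟩ := exists_isAlternatingTensor_range_contractionMatrix_le W hW
    have hd := le_rank_contractionMatrix hp hp0
    have heq := Submodule.eq_of_le_of_finrank_le hle (hW.trans_le hd)
    have hrank : (contractionMatrix p).rank = d := by rw [rank, heq, hW]
    obtain ⟨h1, h2⟩ := key p hrank
    rw [heq] at h1 h2
    exact ⟨p, hp0, hp, h1.2 hA, h2.2 hl⟩
  · rintro ⟨p, hp0, hp, h1, h2⟩
    have hd := le_rank_contractionMatrix hp hp0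
    have hle := rank_le_rank_orbitMatrix (adjointPairMatrix B hB A) (contractionMatrix p)
    have hrank : (contractionMatrix p).rank = d := by omega
    exact ⟨_, ⟨hrank, (key p hrank).2.1 h2⟩, (key p hrank).1.1 h1⟩

theorem isHomogeneous_det {σ R m : Type*} [CommRing R] [Fintype m] [DecidableEq m]
    {M : Matrix m m (MvPolynomial σ R)} {e : ℕ} (hM : ∀ i j, (M i j).IsHomogeneous e) :
    M.det.IsHomogeneous (Fintype.card m * e) := by
  rw [det_apply]
  refine IsHomogeneous.sum _ _ _ fun τ _ => ?_
  have h := IsHomogeneous.prod Finset.univ (fun i => M (τ i) i) (fun _ => e) fun i _ => hM _ _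
  rw [Finset.sum_const, smul_eq_mul, Finset.card_univ] at h
  rw [Units.smul_def]
  exact (homogeneousSubmodule σ R _).smul_of_tower_mem _ h

theorem isHomogeneous_mul_apply {σ R l m n : Type*} [CommRing R] [Fintype m]
    {M : Matrix l m (MvPolynomial σ R)} {N : Matrix m n (MvPolynomial σ R)} {e f : ℕ}
    (hM : ∀ i j, (M i j).IsHomogeneous e) (hN : ∀ i j, (N i j).IsHomogeneous f) (i : l) (j : n) :
    ((M * N) i j).IsHomogeneous (e + f) := by
  rw [mul_apply]
  exact IsHomogeneous.sum _ _ _ fun a _ => (hM i a).mul (hN a j)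

/-- Evaluation of a polynomial in two groups of variables. -/
noncomputable def evalPair {σ τ R : Type*} [CommRing R] (a : τ → R) (x : σ → R) :
    MvPolynomial σ (MvPolynomial τ R) →+* R :=
  (eval x).comp (map (eval a))

theorem evalPair_C {σ τ R : Type*} [CommRing R] (a : τ → R) (x : σ → R) (p : MvPolynomial τ R) :
    evalPair a x (C p) = eval a p := by
  simp [evalPair]

theorem evalPair_X {σ τ R : Type*} [CommRing R] (a : τ → R) (x : σ → R) (i : σ) :
    evalPair a x (X i) = x i := by
  simp [evalPair]

/-- A linear functional on `k^τ` as a polynomial. -/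
noncomputable def linearPolynomial {τ : Type*} [Fintype τ] [DecidableEq τ]
    (f : (τ → k) →ₗ[k] k) : MvPolynomial τ k :=
  ∑ e, C (f (Pi.single e 1)) * X e

theorem eval_linearPolynomial {τ : Type*} [Fintype τ] [DecidableEq τ]
    (f : (τ → k) →ₗ[k] k) (a : τ → k) : eval a (linearPolynomial f) = f a := by
  rw [LinearMap.pi_apply_eq_sum_univ f a, linearPolynomial, map_sum]
  refine Finset.sum_congr rfl fun e _ => ?_
  rw [map_mul, eval_C, eval_X, smul_eq_mul, mul_comm]
  congr 2
  ext b
  simp [Pi.single_apply, eq_comm]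

/-- The entries of the matrices of `A i` and `ρ (A i)` are linear in the coordinates of `A`. -/
noncomputable def adjointPairEntry (B : LinearMap.BilinForm k (Fin n → k)) (hB : B.Nondegenerate)
    (o : Fin r ⊕ Fin r) (u v : Fin n) : (Fin r × Fin n × Fin n → k) →ₗ[k] k where
  toFun a := adjointPairMatrix B hB ((endTupleCoords k n r).symm a) o u v
  map_add' a b := by
    have h (x y : Module.End k (Fin n → k)) : adjointInvolution B hB (x + y) =
        adjointInvolution B hB x + adjointInvolution B hB y := by
      simp [adjointInvolution, LinearMap.dualMap, LinearMap.comp_add, LinearMap.add_comp]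
    cases o <;> simp [adjointPairMatrix, h]
  map_smul' c a := by
    have h (x : Module.End k (Fin n → k)) : adjointInvolution B hB (c • x) =
        c • adjointInvolution B hB x := by
      rw [adjointInvolution, LinearMap.dualMap, map_smul, LinearMap.smul_comp, LinearMap.comp_smul]
      rfl
    cases o <;> simp [adjointPairMatrix, h]

/-- Polynomials in a tensor with coefficients polynomial in an `r`-tuple of matrices. -/
abbrev TensorPolynomial (k : Type*) [Field k] (n r d : ℕ) :=
  MvPolynomial (Fin d → Fin n) (MvPolynomial (Fin r × Fin n × Fin n) k)

theorem isClosed_locusGE [IsAlgClosed k] (B : LinearMap.BilinForm k (Fin n → k))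
    (hB : B.Nondegenerate) (l d : ℕ) :
    IsClosed[endTupleZariski k n r] (locusGE B hB l d r) := by
  let M : Matrix (Fin n) (Fin d × (Fin d → Fin n)) (TensorPolynomial k n r d) := contractionMatrix X
  let T : Fin r ⊕ Fin r → Matrix (Fin n) (Fin n) (TensorPolynomial k n r d) := fun o => of fun u v =>
    C (linearPolynomial (adjointPairEntry B hB o u v))
  let N := orbitMatrix T M
  let G : Matrix (Fin n) (Fin n) (TensorPolynomial k n r d) := (LinearMap.BilinForm.toMatrix' B).map fun c => C (C c)
  let Q := Mᵀ * G * M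
  let alt (ξ : Fin d → Fin n → k) : TensorPolynomial k n r d := ∑ I, C (C (∏ s, ξ s (I s))) * X I
  -- Alternation, invariance and isotropy equations, homogeneous in the tensor variables only. If `l
  -- > d`, the last family is the empty determinant 1, which has no zeros.
  let F : Set (TensorPolynomial k n r d) := {f | ∃ ξ i j, ξ i = ξ j ∧ i ≠ j ∧ f = alt ξ} ∪
    {f | ∃ (u : Fin (d + 1) → _) (v : Fin (d + 1) → _), f = (N.submatrix u v).det} ∪
    {f | ∃ (u : Fin (d + 1 - l) → _) (v : Fin (d + 1 - l) → _), f = (Q.submatrix u v).det}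
  have hM (u v) : (M u v).IsHomogeneous 1 := isHomogeneous_X _ _
  have hT (o u v) : (T o u v).IsHomogeneous 0 := isHomogeneous_C _ _
  have hN (u v) : (N u v).IsHomogeneous 1 := by
    obtain ⟨_ | o, c⟩ := v
    · exact hM u c
    · exact (isHomogeneous_mul_apply (hT o) hM u c : ((T o * M) u c).IsHomogeneous (0 + 1))
  have hQ (u v) : (Q u v).IsHomogeneous (1 + 0 + 1) :=
    isHomogeneous_mul_apply (isHomogeneous_mul_apply (fun i j => hM j i)
      fun i j => isHomogeneous_C _ _) hM u v
  have hF : ∀ f ∈ F, ∃ e, f.IsHomogeneous e := by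
    rintro f ((⟨ξ, i, j, -, -, rfl⟩ | ⟨u, v, rfl⟩) | ⟨u, v, rfl⟩)
    · exact ⟨1, IsHomogeneous.sum _ _ _ fun I _ => (isHomogeneous_X _ _).C_mul _⟩
    · exact ⟨_, isHomogeneous_det fun i j => hN _ _⟩
    · exact ⟨_, isHomogeneous_det fun i j => hQ _ _⟩
  have hφM (a x) : M.map (evalPair a x) = contractionMatrix x := by
    ext u v
    exact evalPair_X a x _
  have hφT (a x o) : (T o).map (evalPair a x) =
      adjointPairMatrix B hB ((endTupleCoords k n r).symm a) o := by
    ext u v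
    exact (evalPair_C a x _).trans (eval_linearPolynomial _ a)
  have hφN (a x) : N.map (evalPair a x) = orbitMatrix
      (adjointPairMatrix B hB ((endTupleCoords k n r).symm a)) (contractionMatrix x) := by
    ext u ⟨_ | o, c⟩
    · exact congr_fun₂ (hφM a x) u c
    · have : ((T o * M).map (evalPair a x)) u c =
          (adjointPairMatrix B hB ((endTupleCoords k n r).symm a) o * contractionMatrix x) u c := by
        rw [Matrix.map_mul, hφM, hφT]
      exact this
  have hφQ (a x) : Q.map (evalPair a x) = (contractionMatrix x)ᵀ * LinearMap.BilinForm.toMatrix' B *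
      contractionMatrix x := by
    have hG : G.map (evalPair a x) = LinearMap.BilinForm.toMatrix' B := by
      ext u v
      exact (evalPair_C a x _).trans (eval_C _)
    rw [Matrix.map_mul, Matrix.map_mul, transpose_map, hφM, hG]
  have hφalt (a x ξ) : evalPair a x (alt ξ) = tensorForm x ξ := by
    simp only [alt, tensorForm_apply, map_sum, map_mul, evalPair_C, evalPair_X, eval_C, mul_comm]
  refine (@isClosed_induced_iff _ _ (zariskiTopology k _) _ _).2 ⟨_, isClosed_setOf_exists_ne_zero F hF, ?_⟩
  ext A
  rw [Set.mem_preimage, Set.mem_ofPred_eq, mem_locusGE_iff]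
  refine exists_congr fun x => and_congr_right fun _ => ?_
  set a := endTupleCoords k n r A with ha
  have hA : A = (endTupleCoords k n r).symm a := by simp [ha]
  have hdet {m m' : Type} {e : ℕ} (P : Matrix m m' (TensorPolynomial k n r d)) (u : Fin e → m) (v : Fin e → m') :
      evalPair a x (P.submatrix u v).det = ((P.map (evalPair a x)).submatrix u v).det := by
    rw [RingHom.map_det]
    rfl
  change (∀ f ∈ F, evalPair a x f = 0) ↔ _
  rw [rank_lt_iff_forall_det_submatrix_eq_zero, rank_lt_iff_forall_det_submatrix_eq_zero, hA,
    ← hφN a x, ← hφQ a x]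
  simp only [← hdet, IsAlternatingTensor, ← hφalt a x]
  constructor
  · intro h
    exact ⟨fun ξ i j h1 h2 => h _ (.inl (.inl ⟨ξ, i, j, h1, h2, rfl⟩)),
      fun u v => h _ (.inl (.inr ⟨u, v, rfl⟩)), fun u v => h _ (.inr ⟨u, v, rfl⟩)⟩
  · rintro ⟨h1, h2, h3⟩ f ((⟨ξ, i, j, hij, hne, rfl⟩ | ⟨u, v, rfl⟩) | ⟨u, v, rfl⟩)
    · exact h1 ξ i j hij hne
    · exact h2 u v
    · exact h3 u v

end Locus

theorem mainTheorem12 {k : Type*} [Field k] [IsAlgClosed k] (hchar : ringChar k ≠ 2)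
    (n r : ℕ) (hn : 0 < n) (hr : 0 < r)
    (B : LinearMap.BilinForm k (Fin n → k)) (hB : B.Nondegenerate)
    (hsymm : (∀ v w, B v w = B w v) ∨ (∀ v w, B v w = -B w v))
    (l d : ℕ) :
    IsClosed[endTupleZariski k n r] (locusGE B hB l d r) ∧
      @IsLocallyClosed _ (endTupleZariski k n r) (locusEQ B hB l d r) := by
  let := endTupleZariski k n r
  refine ⟨isClosed_locusGE B hB l d, ?_⟩
  exact (isClosed_locusGE B hB l d).isLocallyClosed.inter
    (isClosed_locusGE B hB (l + 1) d).isOpen_compl.isLocallyClosed
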